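/- Let $I,J,R$ be integers with $I>J\ge 2$ and $\min(I,2J)>R>J$. A real $I\times J\times 2$ array has rank $1$ if it is the outer product $\mathbf a\circ\mathbf b\circ\mathbf c=(a_ib_jc_k)_{i,j,k}$ of three nonzero real vectors, and the rank of an array $\mathcal Y$ is the smallest number of rank-$1$ arrays whose sum equals $\mathcal Y$. A best rank-$R$ approximation of $\mathcal Z\in\mathbb R^{I\times J\times 2}$ is an array $\mathcal X$ with $\operatorname{rank}(\mathcal X)\le R$ that minimizes $\|\mathcal Z-\mathcal Y\|_F^2$ over all $\mathcal Y\in\mathbb R^{I\times J\times 2}$ with $\operatorname{rank}(\mathcal Y)\le R$, where $\|\cdot\|_F$ is the Frobenius norm (the square root of the sum of the squared entries). Then almost every $\mathcal Z\in\mathbb R^{I\times J\times 2}$, with respect to $2IJ$-dimensional Lebesgue measure, has a best rank-$R$ approximation. -/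

import Mathlib

open MeasureTheory

/-- Real three-way arrays of size `I × J × K`. As an iterated function space this carries the
`I * J * K`-dimensional Lebesgue measure as its `volume`. -/
abbrev ThreeWayArray (I J K : ℕ) : Type := Fin I → Fin J → Fin K → ℝ

namespace ThreeWayArray

/-- The outer vector product `a ∘ b ∘ c`, with entries `a i * b j * c k`. -/
def outer {I J K : ℕ} (a : Fin I → ℝ) (b : Fin J → ℝ) (c : Fin K → ℝ) : ThreeWayArray I J K :=
  fun i j k => a i * b j * c k

/-- An array has rank 1 if it is the outer product of three nonzero vectors. -/
def IsRankOne {I J K : ℕ} (Y : ThreeWayArray I J K) : Prop :=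
  ∃ (a : Fin I → ℝ) (b : Fin J → ℝ) (c : Fin K → ℝ),
    a ≠ 0 ∧ b ≠ 0 ∧ c ≠ 0 ∧ Y = outer a b c

/-- `Y` is the sum of exactly `n` rank-1 arrays. -/
def IsSumOfRankOnes {I J K : ℕ} (n : ℕ) (Y : ThreeWayArray I J K) : Prop :=
  ∃ T : Fin n → ThreeWayArray I J K, (∀ r, IsRankOne (T r)) ∧ Y = ∑ r, T r

/-- The rank of `Y`: the smallest number of rank-1 arrays whose sum equals `Y`
(see `exists_isSumOfRankOnes`: such a number always exists). -/
noncomputable def rank {I J K : ℕ} (Y : ThreeWayArray I J K) : ℕ :=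
  sInf {n : ℕ | IsSumOfRankOnes n Y}

/-- The set `S_R(I,J,K)` of arrays of rank at most `R`. -/
def rankAtMost (I J K R : ℕ) : Set (ThreeWayArray I J K) :=
  {Y | rank Y ≤ R}

/-- The Frobenius norm: the square root of the sum of squares of the entries. -/
noncomputable def frobeniusNorm {I J K : ℕ} (Y : ThreeWayArray I J K) : ℝ :=
  Real.sqrt (∑ i, ∑ j, ∑ k, Y i j k ^ 2)

/-- `X` is a best rank-`R` approximation of `Z`: an optimal solution of the problem of minimizing
`‖Z - Y‖_F ^ 2` over the arrays `Y` of rank at most `R`. -/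
def IsBestRankApprox {I J K : ℕ} (R : ℕ) (Z X : ThreeWayArray I J K) : Prop :=
  X ∈ rankAtMost I J K R ∧
    ∀ Y ∈ rankAtMost I J K R, frobeniusNorm (Z - X) ^ 2 ≤ frobeniusNorm (Z - Y) ^ 2

/-- Every array is a finite sum of rank-1 arrays. -/
theorem exists_isSumOfRankOnes {I J K : ℕ} (Y : ThreeWayArray I J K) :
    ∃ n, IsSumOfRankOnes n Y := by
  classical
  let s : Finset (Fin I × Fin J × Fin K) := Finset.univ.filter fun p => Y p.1 p.2.1 p.2.2 ≠ 0
  let t : Fin I × Fin J × Fin K → ThreeWayArray I J K := fun p =>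
    outer (Pi.single p.1 (Y p.1 p.2.1 p.2.2)) (Pi.single p.2.1 1) (Pi.single p.2.2 1)
  refine ⟨s.card, fun r => t (s.equivFin.symm r).1, fun r => ?_, ?_⟩
  · have h := (Finset.mem_filter.1 (s.equivFin.symm r).2).2
    refine ⟨_, _, _, ?_, ?_, ?_, rfl⟩
    · simpa [Pi.single_eq_zero_iff] using h
    · simp [Pi.single_eq_zero_iff]
    · simp [Pi.single_eq_zero_iff]
  · rw [Equiv.sum_comp s.equivFin.symm (fun q : s => t q.1), Finset.sum_coe_sort s t]
    have h0 : ∀ p, p ∉ s → t p = 0 := by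
      intro p hp
      have h : Y p.1 p.2.1 p.2.2 = 0 := by simpa [s] using hp
      funext i j k
      simp [t, outer, h]
    rw [Finset.sum_subset (Finset.subset_univ s) (fun p _ hp => h0 p hp)]
    funext i j k
    simp only [Finset.sum_apply, t, outer]
    rw [Finset.sum_eq_single (i, j, k)]
    · simp
    · rintro ⟨i', j', k'⟩ _ h
      by_cases hi : i = i'
      · by_cases hj : j = j'
        · by_cases hk : k = k'
          · exact absurd (by rw [hi, hj, hk]) h
          · simp [Pi.single_apply, hk]
        · simp [Pi.single_apply, hj]
      · simp [Pi.single_apply, hi]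
    · simp

end ThreeWayArray

/-! Relax the constraint. The horizontal slices of an array of rank at most `R` lie in a subspace of
dimension at most `R` of the slice space `ℝ^(2J)`. The relaxed problem always has a solution, by
compactness of orthonormal frames (`exists_nearest_in_subspace_of_finrank`). If its optimal subspace
`W` lies in the span of `R` vectors `b ⊗ c`, the relaxed solution has rank at most `R` and solves
the original problem.

To see that `W` is usually of this kind without tracking how it depends on `Z`, fix `Z` and move it
by a product `L_v` of scaled reflections. This scales all norms by one factor, so `L_v W` serves the
moved array (`isBestRankApprox_mapSlices`). That `L_v W` lies in such a span follows from the
nonvanishing of a determinant analytic in `v`, and this determinant is nonzero when `L_v W` is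
spanned by Vandermonde slices. So every `Z` works for almost every `v`
(`ae_exists_isBestRankApprox_mapSlices`). By Fubini, almost every `v` works for almost every `Z`;
one such `v` with `L_v` invertible suffices, since an invertible linear map respects null sets. -/

/-! ### Zero sets of analytic functions. -/

section NullSet

open scoped ContDiff Topology

/-- The zero set of a real analytic function of one variable that does not vanish at `0` is
Lebesgue null. -/
theorem ae_ne_zero_of_contDiff_omega_real {f : ℝ → ℝ} (hf : ContDiff ℝ ω f) (h0 : f 0 ≠ 0) :
    ∀ᵐ t, f t ≠ 0 := by
  have ha : AnalyticOnNhd ℝ f Set.univ := contDiff_omega_iff_analyticOnNhd.1 hf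
  have h1 := ha.preimage_zero_mem_codiscrete h0
  rw [Filter.codiscrete] at h1
  have h2 := ae_restrict_le_codiscreteWithin (μ := (volume : Measure ℝ)) MeasurableSet.univ h1
  rw [Measure.restrict_univ] at h2
  filter_upwards [h2] with t ht
  simpa using ht

/-- The zero set of a real analytic function on a finite-dimensional space that does not vanish
identically is null for every additive Haar measure. -/
theorem ae_ne_zero_of_contDiff_omega {V : Type*} [NormedAddCommGroup V] [NormedSpace ℝ V]
    [FiniteDimensional ℝ V] [MeasurableSpace V] [BorelSpace V] (μ : Measure V)
    [μ.IsAddHaarMeasure] {f : V → ℝ} (hf : ContDiff ℝ ω f) {v₀ : V} (h0 : f v₀ ≠ 0) :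
    ∀ᵐ v ∂μ, f v ≠ 0 := by
  -- Restrict to lines through `v₀` and exchange quantifiers by Fubini: some fixed `t ≠ 0` works for
  -- almost every `u`, and `u ↦ v₀ + t • u` is an affine bijection respecting null sets.
  have hline : ∀ u : V, ∀ᵐ t : ℝ, f (v₀ + t • u) ≠ 0 := fun u =>
    ae_ne_zero_of_contDiff_omega_real (f := fun t : ℝ => f (v₀ + t • u)) (by fun_prop)
      (by simpa using h0)
  have hmeas : MeasurableSet {p : ℝ × V | f (v₀ + p.1 • p.2) ≠ 0} := by
    have : Continuous fun p : ℝ × V => f (v₀ + p.1 • p.2) :=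
      hf.continuous.comp (by fun_prop)
    exact (isOpen_ne_fun this continuous_const).measurableSet
  have hswap : ∀ᵐ t : ℝ, ∀ᵐ u ∂μ, f (v₀ + t • u) ≠ 0 :=
    (Measure.ae_ae_comm hmeas).2 (Filter.Eventually.of_forall hline)
  obtain ⟨t, ht, ht0⟩ : ∃ t : ℝ, (∀ᵐ u ∂μ, f (v₀ + t • u) ≠ 0) ∧ t ≠ 0 :=
    (hswap.and (Measure.ae_ne volume 0)).exists
  have hq : Measure.QuasiMeasurePreserving (fun w : V => t⁻¹ • (w - v₀)) μ μ :=
    (Measure.quasiMeasurePreserving_smul μ (inv_ne_zero ht0)).comp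
      (measurePreserving_sub_right μ v₀).quasiMeasurePreserving
  filter_upwards [hq.ae ht] with w hw
  simpa [smul_smul, mul_inv_cancel₀ ht0] using hw

end NullSet

/-! ### Least squares approximation by subspaces. -/

section Nearest

open Module

theorem Submodule.exists_le_finrank_eq {K V : Type*} [Field K] [AddCommGroup V] [Module K V]
    [FiniteDimensional K V] (W : Submodule K V) {n : ℕ} (h1 : finrank K W ≤ n)
    (h2 : n ≤ finrank K V) : ∃ W' : Submodule K V, W ≤ W' ∧ finrank K W' = n := by
  induction n, h1 using Nat.le_induction with
  | base => exact ⟨W, le_rfl, rfl⟩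
  | succ n hn ih =>
    obtain ⟨W', hle, hW'⟩ := ih (by omega)
    obtain ⟨x, hx⟩ : ∃ x, x ∉ W' := by
      by_contra! h
      have : W' = ⊤ := Submodule.eq_top_iff'.2 h
      rw [this, finrank_top] at hW'
      omega
    refine ⟨W' ⊔ Submodule.span K {x}, hle.trans le_sup_left, ?_⟩
    have hx0 : x ≠ 0 := fun h => hx (h ▸ W'.zero_mem)
    have hdis : W' ⊓ Submodule.span K {x} = ⊥ := by
      rw [← disjoint_iff, Submodule.disjoint_span_singleton' hx0]
      exact hx
    have := Submodule.finrank_sup_add_finrank_inf_eq W' (Submodule.span K {x})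
    rw [hdis, finrank_bot, finrank_span_singleton hx0] at this
    omega

variable {E : Type*} [NormedAddCommGroup E] [InnerProductSpace ℝ E] [FiniteDimensional ℝ E]

theorem isCompact_setOf_orthonormal (n : ℕ) : IsCompact {q : Fin n → E | Orthonormal ℝ q} := by
  have hcl : IsClosed {q : Fin n → E | Orthonormal ℝ q} := by
    simp only [orthonormal_iff_ite, Set.ofPred_forall]
    refine isClosed_iInter fun i => isClosed_iInter fun j => ?_
    exact isClosed_eq (by fun_prop) continuous_const
  refine Metric.isCompact_of_isClosed_isBounded hcl ?_
  refine Metric.isBounded_closedBall (x := (0 : Fin n → E)) (r := 1) |>.subset fun q hq => ?_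
  rw [mem_closedBall_zero_iff, pi_norm_le_iff_of_nonneg zero_le_one]
  exact fun i => (hq.1 i).le

/-- Among all ways of replacing finitely many vectors by vectors of an `n`-dimensional subspace
there is one with least total squared error. -/
theorem exists_nearest_in_subspace_of_finrank {ι : Type*} [Fintype ι] (z : ι → E) {n : ℕ}
    (hn : n ≤ finrank ℝ E) :
    ∃ (W : Submodule ℝ E) (x : ι → E), finrank ℝ W = n ∧ (∀ i, x i ∈ W) ∧
      ∀ (W' : Submodule ℝ E) (y : ι → E), finrank ℝ W' ≤ n → (∀ i, y i ∈ W') →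
        ∑ i, ‖z i - x i‖ ^ 2 ≤ ∑ i, ‖z i - y i‖ ^ 2 := by
  -- For orthonormal `q`, `g q i` is the orthogonal projection of `z i` onto the span of `q`; this
  -- leaves a continuous cost on a compact set of frames.
  let g : (Fin n → E) → ι → E := fun q i => ∑ r, inner ℝ (q r) (z i) • q r
  let cost : (Fin n → E) → ℝ := fun q => ∑ i, ‖z i - g q i‖ ^ 2
  have hframe : ∀ W' : Submodule ℝ E, finrank ℝ W' ≤ n →
      ∃ q : Fin n → E, Orthonormal ℝ q ∧ W' ≤ Submodule.span ℝ (Set.range q) := by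
    intro W' hW'
    obtain ⟨W, hle, hW⟩ := W'.exists_le_finrank_eq hW' hn
    let b := (stdOrthonormalBasis ℝ W).reindex (finCongr hW)
    refine ⟨fun r => (b r : E), b.orthonormal.comp_linearIsometry W.subtypeₗᵢ, ?_⟩
    have hb : Submodule.span ℝ (Set.range b) = ⊤ := by
      rw [← b.coe_toBasis]; exact b.toBasis.span_eq
    have : Submodule.span ℝ (Set.range fun r => (b r : E)) = W := by
      have h2 := congrArg (Submodule.map W.subtype) hb
      rw [Submodule.map_span, ← Set.range_comp, Submodule.map_subtype_top] at h2
      exact h2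
    rw [this]
    exact hle
  obtain ⟨q₁, hq₁, -⟩ := hframe ⊥ (by simp)
  obtain ⟨q, hq, hmin⟩ := (isCompact_setOf_orthonormal (E := E) n).exists_isMinOn ⟨q₁, hq₁⟩
    (f := cost) (by fun_prop : Continuous cost).continuousOn
  refine ⟨Submodule.span ℝ (Set.range q), g q, ?_, fun i => ?_, fun W' y hW' hy => ?_⟩
  · simpa using finrank_span_eq_card hq.linearIndependent
  · exact Submodule.sum_mem _ fun r _ =>
      Submodule.smul_mem _ _ (Submodule.subset_span ⟨r, rfl⟩)
  · obtain ⟨q', hq', hle⟩ := hframe W' hW'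
    refine (hmin hq').trans (Finset.sum_le_sum fun i _ => ?_)
    have horth : inner ℝ (z i - g q' i) (g q' i - y i) = 0 := by
      have hmem : g q' i - y i ∈ Submodule.span ℝ (Set.range q') :=
        Submodule.sub_mem _ (Submodule.sum_mem _ fun r _ =>
          Submodule.smul_mem _ _ (Submodule.subset_span ⟨r, rfl⟩)) (hle (hy i))
      generalize g q' i - y i = w at hmem ⊢
      induction hmem using Submodule.span_induction with
      | mem x hx =>
        obtain ⟨r, rfl⟩ := hx
        rw [inner_sub_left, sub_eq_zero]
        simp only [g, sum_inner, real_inner_smul_left, orthonormal_iff_ite.1 hq']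
        simp [real_inner_comm]
      | zero => simp
      | add x y _ _ hx hy => rw [inner_add_right, hx, hy, add_zero]
      | smul a x _ hx => rw [real_inner_smul_right, hx, mul_zero]
    have := norm_add_sq_real (z i - g q' i) (g q' i - y i)
    rw [horth, sub_add_sub_cancel] at this
    rw [this]
    nlinarith [sq_nonneg ‖g q' i - y i‖]

end Nearest

/-! ### Rank through outer products, and measurability. -/

namespace ThreeWayArray

variable {I J K : ℕ}

theorem outer_eq_zero_of_not_isRankOne {a : Fin I → ℝ} {b : Fin J → ℝ} {c : Fin K → ℝ}
    (h : ¬ IsRankOne (outer a b c)) : outer a b c = 0 := by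
  by_contra h0
  refine h ⟨a, b, c, ?_, ?_, ?_, rfl⟩ <;> rintro rfl <;> exact h0 (by funext i j k; simp [outer])

theorem rank_sum_outer_le {R : ℕ} (a : Fin R → Fin I → ℝ) (b : Fin R → Fin J → ℝ)
    (c : Fin R → Fin K → ℝ) : rank (∑ r, outer (a r) (b r) (c r)) ≤ R := by
  classical
  let s : Finset (Fin R) := Finset.univ.filter fun r => IsRankOne (outer (a r) (b r) (c r))
  have hs : s.card ≤ R := (Finset.card_le_univ s).trans (by simp)
  refine le_trans (Nat.sInf_le ?_) hs
  refine ⟨fun m => outer (a (s.equivFin.symm m)) (b (s.equivFin.symm m)) (c (s.equivFin.symm m)),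
    fun m => (Finset.mem_filter.1 (s.equivFin.symm m).2).2, ?_⟩
  rw [Equiv.sum_comp s.equivFin.symm (fun q : s => outer (a q) (b q) (c q)),
    Finset.sum_coe_sort s fun q => outer (a q) (b q) (c q)]
  refine (Finset.sum_subset (Finset.subset_univ s) fun r _ hr => ?_).symm
  exact outer_eq_zero_of_not_isRankOne fun h => hr (Finset.mem_filter.2 ⟨Finset.mem_univ _, h⟩)

/-- An array has rank at most `R` iff it is a sum of `R` outer products, zero vectors allowed. -/
theorem mem_rankAtMost_iff {R : ℕ} {Y : ThreeWayArray I J K} :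
    Y ∈ rankAtMost I J K R ↔ ∃ p : Fin R → (Fin I → ℝ) × (Fin J → ℝ) × (Fin K → ℝ),
      ∑ r, outer (p r).1 (p r).2.1 (p r).2.2 = Y := by
  constructor
  · intro h
    obtain ⟨n, hn, T, hT, hY⟩ : ∃ n ≤ R, IsSumOfRankOnes n Y :=
      ⟨rank Y, h, Nat.sInf_mem (exists_isSumOfRankOnes Y)⟩
    choose a b c _ _ _ habc using hT
    obtain ⟨d, hd⟩ := Nat.exists_eq_add_of_le hn
    subst hd
    refine ⟨Fin.append (fun r => (a r, b r, c r)) 0, ?_⟩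
    rw [Fin.sum_univ_add, hY]
    have h0 : outer (0 : Fin I → ℝ) (0 : Fin J → ℝ) (0 : Fin K → ℝ) = 0 := by
      funext i j k; simp [outer]
    simp [habc, h0]
  · rintro ⟨p, rfl⟩
    exact rank_sum_outer_le _ _ _

theorem continuous_outer : Continuous fun p : (Fin I → ℝ) × (Fin J → ℝ) × (Fin K → ℝ) =>
    outer p.1 p.2.1 p.2.2 := by
  unfold outer
  fun_prop

/-- The set of arrays that have a best rank-`R` approximation is `σ`-compact. -/
theorem isSigmaCompact_setOf_exists_isBestRankApprox (I J K R : ℕ) :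
    IsSigmaCompact {Z : ThreeWayArray I J K | ∃ X, IsBestRankApprox R Z X} := by
  let P := Fin R → (Fin I → ℝ) × (Fin J → ℝ) × (Fin K → ℝ)
  let Φ : P → ThreeWayArray I J K := fun p => ∑ r, outer (p r).1 (p r).2.1 (p r).2.2
  have hΦ : Continuous Φ :=
    continuous_finsetSum _ fun r _ => continuous_outer.comp (continuous_apply r)
  have hfrob : Continuous fun Y : ThreeWayArray I J K => frobeniusNorm Y := by
    unfold frobeniusNorm
    fun_prop
  -- Each competitor `Y` imposes a closed condition, so `S` is closed. The wanted set is its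
  -- projection, and σ-compactness survives continuous images where closedness need not.
  let S : Set (ThreeWayArray I J K × P) := {w | ∀ Y ∈ rankAtMost I J K R,
    frobeniusNorm (w.1 - Φ w.2) ^ 2 ≤ frobeniusNorm (w.1 - Y) ^ 2}
  have hS : IsClosed S := by
    simp only [S, Set.ofPred_forall]
    refine isClosed_iInter fun Y => isClosed_iInter fun _ => ?_
    exact isClosed_le ((hfrob.comp (continuous_fst.sub (hΦ.comp continuous_snd))).pow 2)
      ((hfrob.comp (continuous_fst.sub continuous_const)).pow 2)
  have hσ : IsSigmaCompact S := isSigmaCompact_univ.of_isClosed_subset hS (Set.subset_univ S)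
  convert hσ.image continuous_fst using 1
  ext Z
  constructor
  · rintro ⟨X, hX, hmin⟩
    obtain ⟨p, hp⟩ := mem_rankAtMost_iff.1 hX
    exact ⟨(Z, p), fun Y hY => by simpa only [Φ, hp] using hmin Y hY, rfl⟩
  · rintro ⟨⟨Z', p⟩, hw, rfl⟩
    exact ⟨Φ p, mem_rankAtMost_iff.2 ⟨p, rfl⟩, hw⟩

/-- Needed to apply Fubini in the main proof. -/
theorem measurableSet_setOf_exists_isBestRankApprox (I J K R : ℕ) :
    MeasurableSet {Z : ThreeWayArray I J K | ∃ X, IsBestRankApprox R Z X} := by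
  obtain ⟨C, hC, hU⟩ := isSigmaCompact_setOf_exists_isBestRankApprox I J K R
  rw [← hU]
  exact MeasurableSet.iUnion fun n => (hC n).isClosed.measurableSet

/-! ### Horizontal slices and the relaxed constraint. -/

/-- The Euclidean space in which the horizontal slices of an array live. -/
abbrev SliceSpace (J K : ℕ) : Type := EuclideanSpace ℝ (Fin J × Fin K)

/-- A horizontal slice as a vector of the Euclidean slice space. -/
def sliceEquiv (J K : ℕ) : (Fin J → Fin K → ℝ) ≃ₗ[ℝ] SliceSpace J K :=
  (LinearEquiv.curry ℝ ℝ (Fin J) (Fin K)).symm.trans (WithLp.linearEquiv 2 ℝ _).symm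

@[simp] theorem sliceEquiv_apply (x : Fin J → Fin K → ℝ) (p : Fin J × Fin K) :
    sliceEquiv J K x p = x p.1 p.2 := rfl

theorem frobeniusNorm_sq (Y : ThreeWayArray I J K) :
    frobeniusNorm Y ^ 2 = ∑ i, ‖sliceEquiv J K (Y i)‖ ^ 2 := by
  rw [frobeniusNorm, Real.sq_sqrt (by positivity)]
  refine Finset.sum_congr rfl fun i _ => ?_
  simp [EuclideanSpace.norm_sq_eq, Fintype.sum_prod_type]

/-- The vectors `b ⊗ c` of the slice space. -/
def IsDecomposable (x : SliceSpace J K) : Prop :=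
  ∃ (b : Fin J → ℝ) (c : Fin K → ℝ), ∀ j k, x (j, k) = b j * c k

/-- The coefficients of the slices along `x r` form the first-mode vector of the `r`-th outer
product. -/
theorem mem_rankAtMost_of_slice_mem_span {R : ℕ} {X : ThreeWayArray I J K}
    {x : Fin R → SliceSpace J K} (hx : ∀ r, IsDecomposable (x r))
    (hX : ∀ i, sliceEquiv J K (X i) ∈ Submodule.span ℝ (Set.range x)) :
    X ∈ rankAtMost I J K R := by
  choose b c hbc using hx
  choose a ha using fun i => (Submodule.mem_span_range_iff_exists_fun ℝ).1 (hX i)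
  refine mem_rankAtMost_iff.2 ⟨fun r => (fun i => a i r, b r, c r), ?_⟩
  funext i j k
  have := congrArg (fun y : SliceSpace J K => y (j, k)) (ha i)
  simp only [sliceEquiv_apply] at this
  rw [← this]
  simp [outer, hbc, mul_assoc]

theorem exists_finrank_le_of_mem_rankAtMost {R : ℕ} {Y : ThreeWayArray I J K}
    (hY : Y ∈ rankAtMost I J K R) : ∃ W : Submodule ℝ (SliceSpace J K),
      Module.finrank ℝ W ≤ R ∧ ∀ i, sliceEquiv J K (Y i) ∈ W := by
  obtain ⟨p, rfl⟩ := mem_rankAtMost_iff.1 hY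
  refine ⟨Submodule.span ℝ (Set.range fun r =>
    sliceEquiv J K fun j k => (p r).2.1 j * (p r).2.2 k), ?_, fun i => ?_⟩
  · exact (finrank_range_le_card (R := ℝ) fun r =>
      sliceEquiv J K fun j k => (p r).2.1 j * (p r).2.2 k).trans (by simp)
  · refine (Submodule.mem_span_range_iff_exists_fun ℝ).2 ⟨fun r => (p r).1 i, ?_⟩
    ext q
    simp [outer, mul_assoc]

end ThreeWayArray

open scoped ContDiff

/-! ### Left null vectors depending polynomially on a matrix. -/

section LeftKernel

open Matrix

variable {m n : Type*} [Fintype m] [Fintype n] [DecidableEq n]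

/-- A multiple of the orthogonal projection of `w` onto the left kernel of `M`, polynomial in the
entries of `M`. -/
def Matrix.leftKernelVec (M : Matrix m n ℝ) (w : m → ℝ) : m → ℝ :=
  (Mᵀ * M).det • w - M *ᵥ ((Mᵀ * M).adjugate *ᵥ (Mᵀ *ᵥ w))

theorem Matrix.leftKernelVec_vecMul (M : Matrix m n ℝ) (w : m → ℝ) :
    M.leftKernelVec w ᵥ* M = 0 := by
  rw [← mulVec_transpose, leftKernelVec, mulVec_sub, mulVec_smul, mulVec_mulVec, mulVec_mulVec,
    mul_adjugate, smul_mulVec, one_mulVec, sub_self]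

theorem Matrix.leftKernelVec_of_vecMul_eq_zero {M : Matrix m n ℝ} {w : m → ℝ}
    (h : w ᵥ* M = 0) : M.leftKernelVec w = (Mᵀ * M).det • w := by
  rw [leftKernelVec, mulVec_transpose, h, mulVec_zero, mulVec_zero, sub_zero]

theorem Matrix.det_transpose_mul_self_ne_zero {M : Matrix m n ℝ}
    (h : ∀ x, M *ᵥ x = 0 → x = 0) : (Mᵀ * M).det ≠ 0 := by
  intro hdet
  obtain ⟨x, hx0, hx⟩ := Matrix.exists_mulVec_eq_zero_iff.2 hdet
  rw [← conjTranspose_eq_transpose_of_trivial, conjTranspose_mul_self_mulVec_eq_zero] at hx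
  exact hx0 (h x hx)

variable {V : Type*} [NormedAddCommGroup V] [NormedSpace ℝ V] {k : WithTop ℕ∞}

theorem ContDiff.matrix_det {A : V → Matrix n n ℝ} (hA : ∀ i j, ContDiff ℝ k fun v => A v i j) :
    ContDiff ℝ k fun v => (A v).det := by
  simp only [Matrix.det_apply']
  exact ContDiff.sum fun σ _ => contDiff_const.mul (contDiff_prod fun i _ => hA _ _)

theorem ContDiff.matrix_adjugate {A : V → Matrix n n ℝ}
    (hA : ∀ i j, ContDiff ℝ k fun v => A v i j) (i j : n) :
    ContDiff ℝ k fun v => (A v).adjugate i j := by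
  simp only [Matrix.adjugate_apply]
  refine ContDiff.matrix_det fun a b => ?_
  by_cases h : a = j
  · subst h; simpa using contDiff_const
  · simpa [Matrix.updateRow_ne h] using hA a b

theorem ContDiff.matrix_leftKernelVec {A : V → Matrix m n ℝ}
    (hA : ∀ i j, ContDiff ℝ k fun v => A v i j) (w : m → ℝ) (i : m) :
    ContDiff ℝ k fun v => (A v).leftKernelVec w i := by
  have hG : ∀ a b, ContDiff ℝ k fun v => ((A v)ᵀ * A v) a b := by
    intro a b
    simp only [Matrix.mul_apply, Matrix.transpose_apply]
    exact ContDiff.sum fun c _ => (hA _ _).mul (hA _ _)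
  simp only [Matrix.leftKernelVec, Pi.sub_apply, Pi.smul_apply, smul_eq_mul, Matrix.mulVec,
    dotProduct, Matrix.transpose_apply]
  refine ((ContDiff.matrix_det hG).mul contDiff_const).sub (ContDiff.sum fun a _ =>
    (hA _ _).mul (ContDiff.sum fun b _ => (ContDiff.matrix_adjugate hG _ _).mul
      (ContDiff.sum fun c _ => (hA _ _).mul contDiff_const)))

end LeftKernel

/-! ### Matrix pencils and spans of decomposable vectors. -/

namespace ThreeWayArray

open Matrix

variable {J R : ℕ}

/-- For a tuple `B` of vectors of the slice space, the matrix `B₁ - t B₀` of its pencil. -/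
def pencil (B : Fin R → SliceSpace J 2) (t : ℝ) : Matrix (Fin R) (Fin J) ℝ :=
  Matrix.of fun r j => B r (j, 1) - t * B r (j, 0)

/-- The coefficient matrix whose row `r` is a left null vector of the pencil of `B` at
`t = r + 1`. -/
def decompositionMatrix (B : Fin R → SliceSpace J 2) : Matrix (Fin R) (Fin R) ℝ :=
  Matrix.of fun r => (pencil B ((r : ℝ) + 1)).leftKernelVec (Pi.single r 1)

/-- A left null vector of `B₁ - t B₀` combines the `B i` into a vector whose second column is `t`
times its first, hence of the form `b ⊗ (1, t)`. -/
theorem isDecomposable_sum_decompositionMatrix (B : Fin R → SliceSpace J 2) (r : Fin R) :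
    IsDecomposable (∑ i, decompositionMatrix B r i • B i) := by
  refine ⟨fun j => (∑ i, decompositionMatrix B r i • B i) (j, 0), ![1, (r : ℝ) + 1],
    fun j k => ?_⟩
  have h := congrFun ((pencil B ((r : ℝ) + 1)).leftKernelVec_vecMul (Pi.single r 1)) j
  have h' : ∑ i, decompositionMatrix B r i * (B i (j, 1) - ((r : ℝ) + 1) * B i (j, 0)) = 0 := h
  fin_cases k
  · simp
  · simp only [mul_sub, Finset.sum_sub_distrib, sub_eq_zero] at h'
    simp only [WithLp.ofLp_sum, WithLp.ofLp_smul, Finset.sum_apply, Pi.smul_apply, smul_eq_mul]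
    simp [h', Finset.sum_mul]
    exact Finset.sum_congr rfl fun i _ => by ring

/-- If the decomposition matrix of `B` is invertible then the vectors of `B` lie in the span of
as many decomposable vectors. -/
theorem exists_isDecomposable_of_det_ne_zero {B : Fin R → SliceSpace J 2}
    (h : (decompositionMatrix B).det ≠ 0) : ∃ x : Fin R → SliceSpace J 2,
      (∀ r, IsDecomposable (x r)) ∧ ∀ i, B i ∈ Submodule.span ℝ (Set.range x) := by
  refine ⟨fun r => ∑ i, decompositionMatrix B r i • B i,
    isDecomposable_sum_decompositionMatrix B, fun l => ?_⟩
  have hinv := Matrix.nonsing_inv_mul (decompositionMatrix B) (isUnit_iff_ne_zero.2 h)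
  refine (Submodule.mem_span_range_iff_exists_fun ℝ).2 ⟨(decompositionMatrix B)⁻¹ l, ?_⟩
  simp only [Finset.smul_sum, smul_smul]
  rw [Finset.sum_comm]
  simp only [← Finset.sum_smul, ← Matrix.mul_apply, hinv, Matrix.one_apply, ite_smul, one_smul,
    zero_smul, Finset.sum_ite_eq, Finset.mem_univ, if_true]

theorem contDiff_det_decompositionMatrix {V : Type*} [NormedAddCommGroup V] [NormedSpace ℝ V]
    {k : WithTop ℕ∞} {B : V → Fin R → SliceSpace J 2} (hB : ∀ r, ContDiff ℝ k fun v => B v r) :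
    ContDiff ℝ k fun v => (decompositionMatrix (B v)).det := by
  refine ContDiff.matrix_det fun r i => ContDiff.matrix_leftKernelVec (fun a b => ?_) _ _
  simp only [pencil, Matrix.of_apply]
  exact (contDiff_euclidean.1 (hB a) _).sub (contDiff_const.mul (contDiff_euclidean.1 (hB a) _))

/-- A tuple of decomposable vectors with powers of `r + 1` as entries. -/
noncomputable def vandermondeSlices (J R : ℕ) (r : Fin R) : SliceSpace J 2 :=
  sliceEquiv J 2 fun j k => ((r : ℝ) + 1) ^ (2 * (j : ℕ) + (k : ℕ))

theorem linearIndependent_vandermondeSlices (hR : R ≤ 2 * J) :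
    LinearIndependent ℝ (vandermondeSlices J R) := by
  rw [Fintype.linearIndependent_iff]
  intro g hg
  have hinj : Function.Injective fun r : Fin R => (r : ℝ) + 1 := fun a b h => by
    simpa [Fin.ext_iff] using h
  refine congrFun (Matrix.eq_zero_of_vecMul_eq_zero (Matrix.det_vandermonde_ne_zero_iff.2 hinj) ?_)
  funext l
  -- Position `(l / 2, l % 2)` carries the exponent `l`, and `l < R ≤ 2 * J` keeps it in range; this
  -- gives a square Vandermonde system.
  have h := congrArg (fun y : SliceSpace J 2 =>
    y (⟨(l : ℕ) / 2, by omega⟩, ⟨(l : ℕ) % 2, by omega⟩)) hg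
  simp only [WithLp.ofLp_sum, WithLp.ofLp_smul, Finset.sum_apply, Pi.smul_apply, smul_eq_mul,
    vandermondeSlices, sliceEquiv_apply, Nat.div_add_mod] at h
  simpa [Matrix.vecMul, dotProduct] using h

/-- At `t = r + 1` row `r` of the pencil vanishes, so the `r`-th unit vector is a left null vector
and the decomposition matrix is diagonal. The other rows are nonzero multiples of Vandermonde rows
with distinct nodes, and `J < R` leaves at least `J` of them; so the pencil has full column rank and
the diagonal entries are nonzero. -/
theorem det_decompositionMatrix_vandermondeSlices_ne_zero (hR : J < R) :
    (decompositionMatrix (vandermondeSlices J R)).det ≠ 0 := by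
  obtain ⟨R, rfl⟩ : ∃ n, R = n + 1 := ⟨R - 1, by omega⟩
  have hpencil : ∀ (r : Fin (R + 1)) (t : ℝ) (j : Fin J),
      pencil (vandermondeSlices J (R + 1)) t r j =
        ((r : ℝ) + 1 - t) * (((r : ℝ) + 1) ^ 2) ^ (j : ℕ) := by
    intro r t j
    simp [pencil, vandermondeSlices, pow_succ, pow_mul]
    ring
  have hinj : ∀ (r : Fin (R + 1)) (x : Fin J → ℝ),
      pencil (vandermondeSlices J (R + 1)) ((r : ℝ) + 1) *ᵥ x = 0 → x = 0 := by
    intro r x hx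
    let f : Fin J → Fin (R + 1) := fun i => r.succAbove (Fin.castLE (by omega) i)
    have hf : Function.Injective f :=
      r.succAbove_right_injective.comp (Fin.castLE_injective _)
    have hsq : Function.Injective fun i => ((f i : ℝ) + 1) ^ 2 := by
      intro a b hab
      apply hf
      have := (pow_left_inj₀ (by positivity) (by positivity) two_ne_zero).1 hab
      simpa [Fin.ext_iff] using this
    refine Matrix.eq_zero_of_mulVec_eq_zero (Matrix.det_vandermonde_ne_zero_iff.2 hsq) ?_
    funext i
    have h := congrFun hx (f i)
    simp only [Matrix.mulVec, dotProduct, hpencil, mul_assoc, ← Finset.mul_sum, Pi.zero_apply,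
      mul_eq_zero] at h
    have hne : (f i : ℝ) + 1 - ((r : ℝ) + 1) ≠ 0 := by
      have : f i ≠ r := Fin.succAbove_ne r _
      simpa [sub_eq_zero, Fin.ext_iff] using this
    simpa [Matrix.mulVec, dotProduct] using h.resolve_left hne
  have hdiag : decompositionMatrix (vandermondeSlices J (R + 1)) = Matrix.diagonal fun r : Fin (R + 1) =>
      ((pencil (vandermondeSlices J (R + 1)) ((r : ℝ) + 1))ᵀ *
        pencil (vandermondeSlices J (R + 1)) ((r : ℝ) + 1)).det := by
    ext r i
    rw [decompositionMatrix, Matrix.of_apply, Matrix.leftKernelVec_of_vecMul_eq_zero]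
    · simp [Matrix.diagonal_apply, Pi.single_apply, eq_comm]
    · funext j
      simp [hpencil]
  rw [hdiag, Matrix.det_diagonal]
  exact Finset.prod_ne_zero_iff.2 fun r _ => Matrix.det_transpose_mul_self_ne_zero (hinj r)

end ThreeWayArray

open scoped ContDiff

/-! ### Similarities as products of scaled reflections. -/

section Reflections

open Module

variable {E : Type*} [NormedAddCommGroup E] [InnerProductSpace ℝ E]

/-- The reflection in the hyperplane orthogonal to `v`, multiplied by `‖v‖ ^ 2`. -/
noncomputable def scaledReflection (v : E) : E →ₗ[ℝ] E :=
  (‖v‖ ^ 2) • LinearMap.id - (2 : ℝ) • (innerₗ E v).smulRight v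

theorem scaledReflection_apply (v x : E) :
    scaledReflection v x = ‖v‖ ^ 2 • x - (2 * inner ℝ v x) • v := by
  simp [scaledReflection, mul_smul]

theorem norm_scaledReflection (v x : E) : ‖scaledReflection v x‖ = ‖v‖ ^ 2 * ‖x‖ := by
  rw [← sq_eq_sq₀ (norm_nonneg _) (by positivity), scaledReflection_apply, norm_sub_sq_real]
  simp only [norm_smul, inner_smul_left, inner_smul_right, real_inner_comm x v, mul_pow,
    Real.norm_eq_abs, sq_abs, conj_trivial]
  ring

theorem scaledReflection_eq_reflection {v : E} (hv : ‖v‖ = 1) (x : E) :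
    scaledReflection v x = (ℝ ∙ v)ᗮ.reflection x := by
  rw [Submodule.reflection_orthogonal_apply, Submodule.reflection_singleton_apply,
    scaledReflection_apply]
  simp [hv, mul_smul, two_smul]

/-- The composition of `n` scaled reflections. -/
noncomputable def scaledReflections : (n : ℕ) → (Fin n → E) → E →ₗ[ℝ] E
  | 0, _ => LinearMap.id
  | n + 1, v => scaledReflection (v 0) ∘ₗ scaledReflections n (Fin.tail v)

/-- The factor is the product of the `‖v i‖ ^ 2`; it vanishes if some `v i` is zero. -/
theorem exists_norm_scaledReflections {n : ℕ} (v : Fin n → E) :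
    ∃ c : ℝ, ∀ x, ‖scaledReflections n v x‖ = c * ‖x‖ := by
  induction n with
  | zero => exact ⟨1, fun x => by simp [scaledReflections]⟩
  | succ n ih =>
    obtain ⟨c, h⟩ := ih (Fin.tail v)
    refine ⟨‖v 0‖ ^ 2 * c, fun x => ?_⟩
    rw [scaledReflections, LinearMap.comp_apply, norm_scaledReflection, h, mul_assoc]

theorem norm_scaledReflections_of_unit {n : ℕ} {v : Fin n → E} (hv : ∀ i, ‖v i‖ = 1) (x : E) :
    ‖scaledReflections n v x‖ = ‖x‖ := by
  induction n with
  | zero => simp [scaledReflections]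
  | succ n ih =>
    rw [scaledReflections, LinearMap.comp_apply, norm_scaledReflection, hv 0, one_pow, one_mul]
    exact ih fun i => hv i.succ

theorem contDiff_scaledReflections {n : ℕ} {k : WithTop ℕ∞} :
    ContDiff ℝ k fun p : (Fin n → E) × E => scaledReflections n p.1 p.2 := by
  induction n with
  | zero => simpa [scaledReflections] using contDiff_snd
  | succ n ih =>
    simp only [scaledReflections, LinearMap.comp_apply, scaledReflection_apply]
    have h0 : ContDiff ℝ k fun p : (Fin (n + 1) → E) × E => p.1 0 := by fun_prop
    have h1 : ContDiff ℝ k fun p : (Fin (n + 1) → E) × E =>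
        scaledReflections n (Fin.tail p.1) p.2 :=
      ih.comp (f := fun p : (Fin (n + 1) → E) × E => (Fin.tail p.1, p.2))
        (by unfold Fin.tail; fun_prop)
    exact ((h0.norm_sq ℝ).smul h1).sub ((contDiff_const.mul (h0.inner ℝ h1)).smul h0)

theorem exists_scaledReflections_eq_prod (l : List E) : ∃ n ≤ l.length, ∃ v : Fin n → E,
    (∀ i, ‖v i‖ = 1) ∧
      ∀ x, scaledReflections n v x = (l.map fun v => (ℝ ∙ v)ᗮ.reflection).prod x := by
  induction l with
  | nil => exact ⟨0, le_rfl, Fin.elim0, fun i => i.elim0, fun x => rfl⟩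
  | cons u l ih =>
    obtain ⟨n, hn, v, hv, h⟩ := ih
    by_cases hu : u = 0
    · refine ⟨n, hn.trans (by simp), v, hv, fun x => ?_⟩
      subst hu
      rw [h, List.map_cons, List.prod_cons, LinearIsometryEquiv.coe_mul, Function.comp_apply,
        Submodule.reflection_mem_subspace_eq_self]
      simp
    · have hspan : (ℝ ∙ (‖u‖⁻¹ • u)) = ℝ ∙ u :=
        Submodule.span_singleton_smul_eq (IsUnit.mk0 _ (inv_ne_zero (norm_ne_zero_iff.2 hu))) u
      have hnorm : ‖‖u‖⁻¹ • u‖ = 1 := by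
        rw [norm_smul, norm_inv, norm_norm, inv_mul_cancel₀ (norm_ne_zero_iff.2 hu)]
      refine ⟨n + 1, by simpa using hn, Fin.cons (‖u‖⁻¹ • u) v, fun i => ?_, fun x => ?_⟩
      · induction i using Fin.cases with
        | zero => exact hnorm
        | succ i => exact hv i
      · rw [scaledReflections, LinearMap.comp_apply, Fin.tail_cons, Fin.cons_zero,
          scaledReflection_eq_reflection hnorm, h, List.map_cons, List.prod_cons,
          LinearIsometryEquiv.coe_mul, Function.comp_apply]
        simp only [hspan]

/-- Two subspaces of the same positive dimension are carried into each other by a product of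
exactly `finrank ℝ E` reflections. -/
theorem exists_map_scaledReflections_eq [FiniteDimensional ℝ E] {W W₀ : Submodule ℝ E}
    (h : finrank ℝ W = finrank ℝ W₀) (hW₀ : W₀ ≠ ⊥) : ∃ v : Fin (finrank ℝ E) → E,
      (∀ i, ‖v i‖ = 1) ∧ W.map (scaledReflections _ v) = W₀ := by
  obtain ⟨φ, hφ⟩ : ∃ φ : E ≃ₗᵢ[ℝ] E, ∀ x ∈ W, φ x ∈ W₀ := by
    let e : W ≃ₗᵢ[ℝ] W₀ := 
      (stdOrthonormalBasis ℝ W).equiv (stdOrthonormalBasis ℝ W₀) (finCongr h)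
    let L : W →ₗᵢ[ℝ] E := W₀.subtypeₗᵢ.comp e.toLinearIsometry
    refine ⟨L.extend.toLinearIsometryEquiv rfl, fun x hx => ?_⟩
    have : L.extend x = L ⟨x, hx⟩ := L.extend_apply ⟨x, hx⟩
    rw [LinearIsometry.coe_toLinearIsometryEquiv, this]
    exact (e ⟨x, hx⟩).2
  -- Cartan–Dieudonné: at most `finrank ℝ E` reflections are needed.
  obtain ⟨l, hl, rfl⟩ := φ.reflections_generate_dim
  obtain ⟨n, hn, v, hv, hvl⟩ := exists_scaledReflections_eq_prod l
  have hpad : ∀ m, n ≤ m → ∃ v : Fin m → E, (∀ i, ‖v i‖ = 1) ∧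
      ∀ x ∈ W, scaledReflections m v x ∈ W₀ := by
    intro m hm
    induction m, hm using Nat.le_induction with
    | base => exact ⟨v, hv, fun x hx => by rw [hvl]; exact hφ x hx⟩
    | succ m _ ih =>
      obtain ⟨v, hv, hvW⟩ := ih
      -- Pad with reflections along a vector of `W₀`, which map `W₀` into itself; the number of
      -- parameters thus becomes independent of the subspaces.
      obtain ⟨w, hw, hw0⟩ := W₀.exists_mem_ne_zero_of_ne_bot hW₀
      refine ⟨Fin.cons (‖w‖⁻¹ • w) v, fun i => ?_, fun x hx => ?_⟩
      · induction i using Fin.cases with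
        | zero =>
          rw [Fin.cons_zero, norm_smul, norm_inv, norm_norm,
            inv_mul_cancel₀ (norm_ne_zero_iff.2 hw0)]
        | succ i => exact hv i
      · rw [scaledReflections, LinearMap.comp_apply, Fin.tail_cons, Fin.cons_zero,
          scaledReflection_apply]
        exact W₀.sub_mem (W₀.smul_mem _ (hvW x hx)) (W₀.smul_mem _ (W₀.smul_mem _ hw))
  obtain ⟨v, hv, hvW⟩ := hpad _ (hn.trans hl)
  refine ⟨v, hv, Submodule.eq_of_le_of_finrank_eq (Submodule.map_le_iff_le_comap.2 hvW) ?_⟩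
  rw [← h]
  refine (LinearEquiv.finrank_eq (Submodule.equivMapOfInjective _ ?_ W)).symm
  refine (injective_iff_map_eq_zero _).2 fun x hx => ?_
  rw [← norm_eq_zero, ← norm_scaledReflections_of_unit hv, hx, norm_zero]

end Reflections

/-! ### Moving arrays by similarities of the slice space. -/

namespace ThreeWayArray

open Module

variable {I J K R : ℕ}

/-- For `J < R ≤ 2 J`, almost every product of scaled reflections carries a given
`R`-dimensional subspace of the slice space into the span of `R` decomposable vectors. -/
theorem ae_exists_isDecomposable_scaledReflections (hJR : J < R) (hR : R ≤ 2 * J)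
    {W : Submodule ℝ (SliceSpace J 2)} (hW : finrank ℝ W = R) :
    ∀ᵐ v : Fin (finrank ℝ (SliceSpace J 2)) → SliceSpace J 2,
      ∃ x : Fin R → SliceSpace J 2, (∀ r, IsDecomposable (x r)) ∧
        ∀ w ∈ W, scaledReflections _ v w ∈ Submodule.span ℝ (Set.range x) := by
  have hli := linearIndependent_vandermondeSlices hR
  have hfin : finrank ℝ (Submodule.span ℝ (Set.range (vandermondeSlices J R))) = R := by
    simpa using finrank_span_eq_card hli
  have hne : Submodule.span ℝ (Set.range (vandermondeSlices J R)) ≠ ⊥ := by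
    intro h
    rw [h, finrank_bot] at hfin
    omega
  obtain ⟨v₀, -, hmap⟩ := exists_map_scaledReflections_eq (hW.trans hfin.symm) hne
  have hmem : ∀ r, vandermondeSlices J R r ∈ W.map (scaledReflections _ v₀) := fun r => by
    rw [hmap]
    exact Submodule.subset_span ⟨r, rfl⟩
  -- `β` is the basis of `W` that `v₀` carries to the Vandermonde slices, so the determinant below
  -- is nonzero at `v₀`.
  choose β hβW hβ using hmem
  have hβli : LinearIndependent ℝ β := by
    have hcomp : scaledReflections _ v₀ ∘ β = vandermondeSlices J R := funext hβ
    exact LinearIndependent.of_comp (scaledReflections _ v₀) (hcomp ▸ hli)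
  have hspan : Submodule.span ℝ (Set.range β) = W := by
    refine Submodule.eq_of_le_of_finrank_eq ?_ ?_
    · rw [Submodule.span_le]
      rintro _ ⟨r, rfl⟩
      exact hβW r
    · rw [hW]
      simpa using finrank_span_eq_card hβli
  have hF := ae_ne_zero_of_contDiff_omega volume (v₀ := v₀)
    (f := fun v => (decompositionMatrix fun r => scaledReflections _ v (β r)).det)
    (contDiff_det_decompositionMatrix fun r =>
      contDiff_scaledReflections.comp (contDiff_id.prodMk contDiff_const))
    (by simpa only [hβ] using det_decompositionMatrix_vandermondeSlices_ne_zero hJR)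
  filter_upwards [hF] with v hv
  obtain ⟨x, hx, hmem⟩ := exists_isDecomposable_of_det_ne_zero hv
  refine ⟨x, hx, ?_⟩
  rw [← hspan]
  change Submodule.span ℝ (Set.range β) ≤
    (Submodule.span ℝ (Set.range x)).comap (scaledReflections _ v)
  rw [Submodule.span_le]
  rintro _ ⟨r, rfl⟩
  exact hmem r

/-- Apply a linear map to all horizontal slices of an array. -/
noncomputable def mapSlices (L : SliceSpace J K →ₗ[ℝ] SliceSpace J K)
    (Z : ThreeWayArray I J K) : ThreeWayArray I J K :=
  fun i => (sliceEquiv J K).symm (L (sliceEquiv J K (Z i)))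

theorem sliceEquiv_mapSlices (L : SliceSpace J K →ₗ[ℝ] SliceSpace J K)
    (Z : ThreeWayArray I J K) (i : Fin I) :
    sliceEquiv J K (mapSlices L Z i) = L (sliceEquiv J K (Z i)) := by
  simp [mapSlices]

/-- If the slices of `X` are a best approximation to those of `Z` within subspaces of dimension
at most `R`, then this optimality persists under maps `L` that scale all norms by `c`; so if the
image of `X` has rank at most `R`, it is a best rank-`R` approximation of the image of `Z`. -/
theorem isBestRankApprox_mapSlices {Z X : ThreeWayArray I J K}
    (hmin : ∀ (W' : Submodule ℝ (SliceSpace J K)) (y : Fin I → SliceSpace J K),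
      finrank ℝ W' ≤ R → (∀ i, y i ∈ W') →
        ∑ i, ‖sliceEquiv J K (Z i) - sliceEquiv J K (X i)‖ ^ 2 ≤
          ∑ i, ‖sliceEquiv J K (Z i) - y i‖ ^ 2)
    {L : SliceSpace J K →ₗ[ℝ] SliceSpace J K} {c : ℝ} (hL : ∀ x, ‖L x‖ = c * ‖x‖)
    (hX : mapSlices L X ∈ rankAtMost I J K R) :
    IsBestRankApprox R (mapSlices L Z) (mapSlices L X) := by
  refine ⟨hX, fun Y hY => ?_⟩
  simp only [frobeniusNorm_sq, Pi.sub_apply, map_sub, sliceEquiv_mapSlices]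
  simp only [← map_sub L, hL, mul_pow, ← Finset.mul_sum]
  by_cases hc : c = 0
  · rw [hc]
    simp only [ne_eq, OfNat.ofNat_ne_zero, not_false_eq_true, zero_pow, zero_mul]
    positivity
  have hinj : Function.Injective L := (injective_iff_map_eq_zero _).2 fun x hx => by
    have h := hL x
    rw [hx, norm_zero, eq_comm, mul_eq_zero, norm_eq_zero] at h
    exact h.resolve_left hc
  let e := LinearEquiv.ofInjectiveEndo L hinj
  have he : ∀ y, L (e.symm y) = y := fun y => e.apply_symm_apply y
  obtain ⟨W', hW', hYW'⟩ := exists_finrank_le_of_mem_rankAtMost hY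
  -- Pull the competitor `Y` back through the bijection `L` and compare before scaling.
  have h := hmin (W'.map (e.symm : SliceSpace J K →ₗ[ℝ] SliceSpace J K))
    (fun i => e.symm (sliceEquiv J K (Y i))) ((Submodule.finrank_map_le _ _).trans hW')
    fun i => Submodule.mem_map_of_mem (hYW' i)
  refine (mul_le_mul_of_nonneg_left h (sq_nonneg c)).trans_eq ?_
  rw [Finset.mul_sum]
  refine Finset.sum_congr rfl fun i _ => ?_
  rw [← mul_pow, ← hL, map_sub, he]

theorem ae_exists_isBestRankApprox_mapSlices (hJR : J < R) (hR : R ≤ 2 * J)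
    (Z : ThreeWayArray I J 2) :
    ∀ᵐ v : Fin (finrank ℝ (SliceSpace J 2)) → SliceSpace J 2,
      ∃ X, IsBestRankApprox R (mapSlices (scaledReflections _ v) Z) X := by
  obtain ⟨W, x, hW, hxW, hmin⟩ := exists_nearest_in_subspace_of_finrank
    (fun i => sliceEquiv J 2 (Z i)) (n := R) (by simp; omega)
  filter_upwards [ae_exists_isDecomposable_scaledReflections hJR hR hW] with v hv
  obtain ⟨b, hb, hbW⟩ := hv
  obtain ⟨c, hc⟩ := exists_norm_scaledReflections v
  let X : ThreeWayArray I J 2 := fun i => (sliceEquiv J 2).symm (x i)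
  have hX : ∀ i, sliceEquiv J 2 (X i) = x i := fun i => (sliceEquiv J 2).apply_symm_apply _
  refine ⟨_, isBestRankApprox_mapSlices (X := X) (by simpa only [hX] using hmin) hc ?_⟩
  refine mem_rankAtMost_of_slice_mem_span hb fun i => ?_
  rw [sliceEquiv_mapSlices, hX]
  exact hbW _ (hxW i)

theorem continuous_mapSlices_scaledReflections {n : ℕ} :
    Continuous fun p : (Fin n → SliceSpace J K) × ThreeWayArray I J K =>
      mapSlices (scaledReflections n p.1) p.2 := by
  have h1 : Continuous (sliceEquiv J K) :=
    (sliceEquiv J K).toLinearMap.continuous_of_finiteDimensional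
  have h2 : Continuous (sliceEquiv J K).symm :=
    (sliceEquiv J K).symm.toLinearMap.continuous_of_finiteDimensional
  refine continuous_pi fun i => h2.comp ?_
  exact (contDiff_scaledReflections (k := 0)).continuous.comp
    (continuous_fst.prodMk (h1.comp ((continuous_apply i).comp continuous_snd)))

instance isAddHaarMeasure_volume :
    (volume : Measure (ThreeWayArray I J K)).IsAddHaarMeasure :=
  haveI : (volume : Measure (Fin J → Fin K → ℝ)).IsAddHaarMeasure :=
    Measure.pi.isAddHaarMeasure fun _ => volume
  Measure.pi.isAddHaarMeasure fun _ => volume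

/-- An invertible linear map of the slice space reflects null sets of arrays. -/
theorem ae_of_ae_mapSlices {L : SliceSpace J K →ₗ[ℝ] SliceSpace J K}
    (hL : Function.Injective L) {p : ThreeWayArray I J K → Prop}
    (h : ∀ᵐ Z : ThreeWayArray I J K, p (mapSlices L Z)) : ∀ᵐ Z : ThreeWayArray I J K, p Z := by
  let e := LinearEquiv.ofInjectiveEndo L hL
  let A : ThreeWayArray I J K ≃ₗ[ℝ] ThreeWayArray I J K := LinearEquiv.piCongrRight fun _ =>
    (sliceEquiv J K).trans (e.trans (sliceEquiv J K).symm)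
  have hA : ∀ Z, mapSlices L Z = A Z := fun Z => rfl
  have hq := Measure.LinearMap.quasiMeasurePreserving (volume : Measure (ThreeWayArray I J K))
    (A.symm : ThreeWayArray I J K →ₗ[ℝ] ThreeWayArray I J K) (LinearEquiv.isUnit_det' _).ne_zero
  filter_upwards [hq.ae h] with Z hZ
  simpa only [hA, LinearEquiv.coe_coe, LinearEquiv.apply_symm_apply] using hZ

end ThreeWayArray

theorem corollary4p2 (I J R : ℕ) (hJ : 2 ≤ J) (hIJ : J < I) (hRJ : J < R)
    (hR : R < min I (2 * J)) :
    ∀ᵐ Z : ThreeWayArray I J 2 ∂volume,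
      ∃ X : ThreeWayArray I J 2, ThreeWayArray.IsBestRankApprox R Z X := by
  open ThreeWayArray in
  have hR2 : R ≤ 2 * J := (hR.trans_le (min_le_right _ _)).le
  let n := Module.finrank ℝ (SliceSpace J 2)
  have hmeas : MeasurableSet {p : (Fin n → SliceSpace J 2) × ThreeWayArray I J 2 |
      ∃ X, IsBestRankApprox R (mapSlices (scaledReflections n p.1) p.2) X} :=
    continuous_mapSlices_scaledReflections.measurable
      (measurableSet_setOf_exists_isBestRankApprox I J 2 R)
  have hswap : ∀ᵐ v : Fin n → SliceSpace J 2, ∀ᵐ Z : ThreeWayArray I J 2,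
      ∃ X, IsBestRankApprox R (mapSlices (scaledReflections n v) Z) X :=
    (Measure.ae_ae_comm hmeas).2
      (Filter.Eventually.of_forall (ae_exists_isBestRankApprox_mapSlices hRJ hR2))
  obtain ⟨u, hu⟩ : ∃ u : SliceSpace J 2, ‖u‖ = 1 :=
    ⟨EuclideanSpace.single (⟨0, by omega⟩, 0) 1, by simp⟩
  have hopen : IsOpen {v : Fin n → SliceSpace J 2 | scaledReflections n v u ≠ 0} :=
    isOpen_ne_fun ((contDiff_scaledReflections (k := 0)).continuous.comp
      (continuous_id.prodMk continuous_const)) continuous_const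
  -- A set of full measure is dense, so it meets the nonempty open set where `u` is not killed. As
  -- the map scales all norms by one factor, it is then injective.
  obtain ⟨v, hv0, hv⟩ := (Measure.dense_of_ae hswap).inter_open_nonempty _ hopen
    ⟨fun _ => u, fun h => by
      have := norm_scaledReflections_of_unit (v := fun _ : Fin n => u) (fun _ => hu) u
      rw [h, norm_zero, hu] at this
      exact zero_ne_one this⟩
  obtain ⟨c, hc⟩ := exists_norm_scaledReflections v
  have hc0 : c ≠ 0 := by
    rintro rfl
    exact hv0 (norm_eq_zero.1 (by rw [hc, zero_mul]))
  refine ae_of_ae_mapSlices ((injective_iff_map_eq_zero _).2 fun x hx => ?_) hv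
  have h := hc x
  rw [hx, norm_zero, eq_comm, mul_eq_zero, norm_eq_zero] at h
  exact h.resolve_left hc0
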